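/- Let $H$ be a separable complex Hilbert space and let $\mathcal A\subseteq\mathcal B(H)$ be a commutative $C^*$-algebra, that is, a norm-closed commutative $*$-subalgebra of $\mathcal B(H)$ (not necessarily containing the identity operator). Let $\widehat{\mathcal A}$ be the spectrum of $\mathcal A$: the space of characters (nonzero multiplicative continuous linear functionals) of $\mathcal A$ with the weak-$*$ topology. Then the following conditions are equivalent: (i) $\mathcal A$ is left projective: for every left Banach $\mathcal A$-module $Y$ and every bounded left $\mathcal A$-module morphism $\varphi:Y\to\mathcal A$ that has a bounded linear right inverse, there is a bounded left $\mathcal A$-module morphism $\psi:\mathcal A\to Y$ with $\varphi\circ\psi=\mathrm{id}_{\mathcal A}$; (ii) $\widehat{\mathcal A}$ is paracompact; (iii) $\mathcal A$ contains a strictly positive element, that is, an element $h\ge 0$ with $f(h)>0$ for every nonzero positive continuous linear functional $f$ on $\mathcal A$; (iv) $\widehat{\mathcal A}$ is $\sigma$-compact; (v) $\widehat{\mathcal A}$ is a Lindelöf space; (vi) $\mathcal A$ has a sequential approximate identity bounded by one, that is, there are $e_n\in\mathcal A$ ($n\in\mathbb N$) with $\|e_n\|\le 1$ and $\|ae_n-a\|\to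 0$, $\|e_na-a\|\to 0$ for all $a\in\mathcal A$; (vii) $\mathcal H^2(\mathcal A,X)=\{0\}$ for every Banach $\mathcal A$-bimodule $X$ with $X\cdot\mathcal A=\{0\}$, where $\mathcal H^2(\mathcal A,X)$ is the second continuous Hochschild cohomology group, i.e. the space of bounded bilinear maps $f:\mathcal A\times\mathcal A\to X$ with $a\cdot f(b,c)-f(ab,c)+f(a,bc)-f(a,b)\cdot c=0$ for all $a,b,c\in\mathcal A$, modulo those of the form $f(a,b)=a\cdot g(b)-g(ab)+g(a)\cdot b$ with $g:\mathcal A\to X$ bounded linear. -/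

import Mathlib

open scoped ComplexOrder Topology

universe u v

namespace BanachHomology

/-- A left Banach module structure on the complex Banach space `X` over the (not necessarily
unital) Banach algebra `A`: a bounded bilinear associative action `(a, x) ↦ a · x`. -/
structure LeftModule (A : Type u) [NonUnitalNormedRing A] [NormedSpace ℂ A]
    (X : Type v) [NormedAddCommGroup X] [NormedSpace ℂ X] where
  /-- `lact a x` is `a · x`. -/
  lact : A →L[ℂ] X →L[ℂ] X
  mul_lact : ∀ (a b : A) (x : X), lact (a * b) x = lact a (lact b x)

/-- A Banach bimodule structure on the complex Banach space `X` over the Banach algebra `A`. -/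
structure Bimodule (A : Type u) [NonUnitalNormedRing A] [NormedSpace ℂ A]
    (X : Type v) [NormedAddCommGroup X] [NormedSpace ℂ X] extends LeftModule A X where
  /-- `ract a x` is `x · a`. -/
  ract : A →L[ℂ] X →L[ℂ] X
  mul_ract : ∀ (a b : A) (x : X), ract (a * b) x = ract b (ract a x)
  lact_ract : ∀ (a b : A) (x : X), lact a (ract b x) = ract b (lact a x)

/-- The algebra `A` as a left Banach module over itself, by multiplication. -/
noncomputable def LeftModule.self (A : Type u) [NonUnitalNormedRing A] [NormedSpace ℂ A]
    [IsScalarTower ℂ A A] [SMulCommClass ℂ A A] : LeftModule A A where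
  lact := ContinuousLinearMap.mul ℂ A
  mul_lact a b x := by simp [mul_assoc]

/-- A bounded linear map is a morphism of left Banach modules. -/
def IsMorphism {A : Type u} [NonUnitalNormedRing A] [NormedSpace ℂ A]
    {X Y : Type*} [NormedAddCommGroup X] [NormedSpace ℂ X]
    [NormedAddCommGroup Y] [NormedSpace ℂ Y]
    (M : LeftModule A X) (N : LeftModule A Y) (φ : X →L[ℂ] Y) : Prop :=
  ∀ (a : A) (x : X), φ (M.lact a x) = N.lact a (φ x)

/-- The left Banach module `P` is projective: every morphism of left Banach modules `φ : Y → P`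
which has a right inverse among bounded linear maps (so that `φ` is onto) has a right inverse among
morphisms of left Banach modules. The test modules live in the universe of `A` and `P`, which is
large enough to contain the canonical test module `A₊ ⊗̂ P`. -/
def IsProjective {A : Type u} [NonUnitalNormedRing A] [NormedSpace ℂ A]
    {P : Type u} [NormedAddCommGroup P] [NormedSpace ℂ P] (M : LeftModule A P) : Prop :=
  ∀ (Y : Type u) [NormedAddCommGroup Y] [NormedSpace ℂ Y] [CompleteSpace Y]
    (N : LeftModule A Y) (φ : Y →L[ℂ] P), IsMorphism N M φ →
    (∃ σ : P →L[ℂ] Y, φ ∘L σ = ContinuousLinearMap.id ℂ P) →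
    ∃ ψ : P →L[ℂ] Y, IsMorphism M N ψ ∧ φ ∘L ψ = ContinuousLinearMap.id ℂ P

/-- The Banach algebra `A` is left projective. -/
def IsLeftProjective (A : Type u) [NonUnitalNormedRing A] [NormedSpace ℂ A]
    [IsScalarTower ℂ A A] [SMulCommClass ℂ A A] : Prop :=
  IsProjective (LeftModule.self A)

namespace Bimodule

variable {A : Type u} [NonUnitalNormedRing A] [NormedSpace ℂ A]
  {X : Type v} [NormedAddCommGroup X] [NormedSpace ℂ X]

/-- The bimodule `X` is right annihilator: `X · A = {0}`. -/
def IsRightAnnihilator (M : Bimodule A X) : Prop := ∀ (a : A) (x : X), M.ract a x = 0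

/-- The continuous Hochschild `2`-cocycles: bounded bilinear maps `f : A × A → X` with
`a · f(b, c) - f(ab, c) + f(a, bc) - f(a, b) · c = 0`. -/
def cocycles₂ (M : Bimodule A X) : Submodule ℂ (A →L[ℂ] A →L[ℂ] X) where
  carrier := {f | ∀ a b c : A,
    M.lact a (f b c) - f (a * b) c + f a (b * c) - M.ract c (f a b) = 0}
  zero_mem' a b c := by simp
  add_mem' {f g} hf hg a b c := by
    have h := congrArg₂ (· + ·) (hf a b c) (hg a b c)
    simp only [add_zero] at h
    rw [← h]
    simp only [add_apply, map_add]
    abel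
  smul_mem' r f hf a b c := by
    have h := congrArg (r • ·) (hf a b c)
    simp only [smul_zero, smul_add, smul_sub] at h
    simpa only [smul_apply, map_smul] using h

/-- The continuous Hochschild `2`-coboundaries: the bilinear maps
`(a, b) ↦ a · g(b) - g(ab) + g(a) · b` with `g : A → X` bounded linear. -/
def coboundaries₂ (M : Bimodule A X) : Submodule ℂ (A →L[ℂ] A →L[ℂ] X) where
  carrier := {f | ∃ g : A →L[ℂ] X, ∀ a b : A,
    f a b = M.lact a (g b) - g (a * b) + M.ract b (g a)}
  zero_mem' := ⟨0, fun a b => by simp⟩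
  add_mem' := by
    rintro f f' ⟨g, hg⟩ ⟨g', hg'⟩
    refine ⟨g + g', fun a b => ?_⟩
    simp only [add_apply, map_add, hg, hg']
    abel
  smul_mem' := by
    rintro r f ⟨g, hg⟩
    refine ⟨r • g, fun a b => ?_⟩
    simp only [smul_apply, map_smul, hg, smul_add, smul_sub]

theorem coboundaries₂_le_cocycles₂ (M : Bimodule A X) : M.coboundaries₂ ≤ M.cocycles₂ := by
  rintro f ⟨g, hg⟩ a b c
  simp only [hg, map_add, map_sub, M.mul_lact, M.mul_ract, M.lact_ract, mul_assoc]
  abel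

set_option maxSynthPendingDepth 5 in
/-- The second continuous Hochschild cohomology group of `A` with coefficients in `X`. -/
abbrev H₂ (M : Bimodule A X) : Type (max u v) :=
  M.cocycles₂ ⧸ M.coboundaries₂.submoduleOf M.cocycles₂

end Bimodule

/-- `h` is a strictly positive element of the C⋆-algebra `A`: it is positive, that is, of the form
`b⋆ b`, and every nonzero positive bounded linear functional is strictly positive at `h`. -/
def IsStrictlyPositiveElement {A : Type u} [NonUnitalNormedRing A] [NormedSpace ℂ A] [Star A]
    (h : A) : Prop :=
  (∃ b : A, h = star b * b) ∧
    ∀ f : A →L[ℂ] ℂ, (∀ a : A, 0 ≤ f (star a * a)) → f ≠ 0 → 0 < f h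

/-- `A` has a sequential (two-sided) approximate identity bounded by one. -/
def HasSequentialApproxIdentity (A : Type u) [NonUnitalNormedRing A] : Prop :=
  ∃ e : ℕ → A, (∀ n, ‖e n‖ ≤ 1) ∧ ∀ a : A,
    Filter.Tendsto (fun n => a * e n) Filter.atTop (𝓝 a) ∧
    Filter.Tendsto (fun n => e n * a) Filter.atTop (𝓝 a)

/-- `H²(A, X) = 0` for every right annihilator Banach `A`-bimodule `X`. -/
def H₂VanishesOnRightAnnihilator (A : Type u) [NonUnitalNormedRing A] [NormedSpace ℂ A] : Prop :=
  ∀ (X : Type u) [NormedAddCommGroup X] [NormedSpace ℂ X] [CompleteSpace X] (M : Bimodule A X),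
    M.IsRightAnnihilator → Subsingleton M.H₂

end BanachHomology

/-! By Gelfand duality, applied to the unitization, $\mathcal A$ is $C_0$ of its spectrum. Every
condition is compared with one hub, `HasSeqWithoutCommonZero`: countably many elements of $\mathcal
A$ have no common zero on $\widehat{\mathcal A}$.

Separability of $H$ is used once, to find $a_0$ with trivial annihilator
(`exists_forall_mul_eq_zero`). The set $\{a_0\ne0\}$ is then a dense $\sigma$-compact subset of
$\widehat{\mathcal A}$, and it makes paracompactness and projectivity countable conditions. A
locally finite cover has only countably many nonempty members, since each meets this set. A module
section $F$ of the restriction of functions $\widehat{\mathcal A}\to\mathcal A$ to the diagonal maps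
this set to a separable set $F(a_0)(\{a_0\ne0\})$, and a countable set whose closure contains it has
no common zero.

Conversely, a sequence without common zero is condensed into one $h$ in the unit ball, strictly
positive on characters, whose cutoffs $e_n$ form an approximate identity. Given a linear section
$\sigma$ of $\varphi$, the series $\sum_n a(e_{n+2}-e_{n+1})\cdot\sigma(e_{n+3}-e_n)$ is a module
section. It converges because averaging over signs bounds a diagonal sum of a bilinear map by signed
sums of its arguments, and these are controlled pointwise by telescoping.

Condition (vii) is projectivity in terms of extensions: with zero right action, a 2-cocycle is
exactly the datum of a linearly split extension of left modules. -/

namespace BanachHomology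

open WeakDual Filter

/-! ### Gelfand theory for a non-unital algebra through its unitization -/

section Characters

variable {A : Type u} [NonUnitalCommCStarAlgebra A]

/-- The unique unital extension of a character to the unitization. -/
noncomputable def characterExtension (χ : characterSpace ℂ A) :
    characterSpace ℂ (Unitization ℂ A) :=
  CharacterSpace.equivAlgHom.symm (Unitization.lift (CharacterSpace.toNonUnitalAlgHom χ))

theorem characterExtension_apply (χ : characterSpace ℂ A) (x : Unitization ℂ A) :
    characterExtension χ x = x.fst + χ x.snd := by
  change Unitization.lift (CharacterSpace.toNonUnitalAlgHom χ) x = _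
  simp [Unitization.lift]

@[simp]
theorem characterExtension_inr (χ : characterSpace ℂ A) (a : A) :
    characterExtension χ (a : Unitization ℂ A) = χ a := by
  simp [characterExtension_apply]

variable (A) in
/-- The character of the unitization that vanishes on the algebra: the point at infinity. -/
noncomputable def characterAtInfinity : characterSpace ℂ (Unitization ℂ A) :=
  CharacterSpace.equivAlgHom.symm (Unitization.fstHom ℂ A)

theorem characterAtInfinity_apply (x : Unitization ℂ A) : characterAtInfinity A x = x.fst := rfl

theorem characterExtension_ne_characterAtInfinity (χ : characterSpace ℂ A) :
    characterExtension χ ≠ characterAtInfinity A := by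
  intro h
  refine χ.2.1 (ContinuousLinearMap.ext fun a => ?_)
  have := DFunLike.congr_fun h (a : Unitization ℂ A)
  rw [characterExtension_inr, characterAtInfinity_apply] at this
  exact this

theorem continuous_character_apply (a : A) : Continuous fun χ : characterSpace ℂ A => χ a :=
  (eval_continuous a).comp continuous_subtype_val

theorem exists_character_apply_ne_zero (χ : characterSpace ℂ A) : ∃ a, χ a ≠ 0 := by
  by_contra! h
  exact χ.2.1 (ContinuousLinearMap.ext h)

/-- A unital character is determined by its restriction to `A`, so only the point at infinity is
missed by the extension map. -/
theorem exists_characterExtension_eq (Φ : characterSpace ℂ (Unitization ℂ A)) {a : A}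
    (ha : Φ (a : Unitization ℂ A) ≠ 0) : ∃ χ : characterSpace ℂ A, characterExtension χ = Φ := by
  let f : A →L[ℂ] ℂ := (CharacterSpace.toCLM Φ).comp
    ⟨(Unitization.inrHom ℂ ℂ A), Unitization.continuous_inr⟩
  have hf : ∀ b, f b = Φ (b : Unitization ℂ A) := fun b => rfl
  let χ : characterSpace ℂ A := ⟨f, fun h => ha ((hf a).symm.trans (DFunLike.congr_fun h a)),
    fun x y => by
      change f (x * y) = f x * f y
      simp only [hf, Unitization.inr_mul, map_mul]⟩
  refine ⟨χ, CharacterSpace.ext fun x => ?_⟩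
  rw [characterExtension_apply]
  change x.fst + Φ (x.snd : Unitization ℂ A) = Φ x
  conv_rhs => rw [← Unitization.inl_fst_add_inr_snd_eq x]
  rw [map_add]
  congr 1
  exact (AlgHomClass.commutes Φ x.fst).symm

/-- The Gelfand transform of the unitization is isometric, and characters that do not come from `A`
contribute zero. -/
theorem norm_le_of_forall_character {a : A} {C : ℝ} (hC : 0 ≤ C)
    (h : ∀ χ : characterSpace ℂ A, ‖χ a‖ ≤ C) : ‖a‖ ≤ C := by
  rw [← Unitization.norm_inr (𝕜 := ℂ) a,
    ← (gelfandTransform_isometry (Unitization ℂ A)).norm_map_of_map_zero (map_zero _)]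
  refine (ContinuousMap.norm_le _ hC).2 fun Φ => ?_
  change ‖Φ (a : Unitization ℂ A)‖ ≤ C
  by_cases h0 : Φ (a : Unitization ℂ A) = 0
  · simpa [h0] using hC
  · obtain ⟨χ, rfl⟩ := exists_characterExtension_eq Φ h0
    simpa using h χ

theorem eq_of_forall_character {a b : A} (h : ∀ χ : characterSpace ℂ A, χ a = χ b) : a = b := by
  rw [← sub_eq_zero, ← norm_le_zero_iff]
  exact norm_le_of_forall_character le_rfl fun χ => by simp [h χ]

theorem norm_character_apply_le (χ : characterSpace ℂ A) (a : A) : ‖χ a‖ ≤ ‖a‖ := by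
  rw [← Unitization.norm_inr (𝕜 := ℂ) a, ← characterExtension_inr,
    ← (gelfandTransform_isometry (Unitization ℂ A)).norm_map_of_map_zero (map_zero _)]
  exact ContinuousMap.norm_coe_le_norm
    (gelfandTransform ℂ (Unitization ℂ A) (a : Unitization ℂ A)) (characterExtension χ)

theorem character_star (χ : characterSpace ℂ A) (a : A) : χ (star a) = star (χ a) := by
  rw [← characterExtension_inr, Unitization.inr_star, map_star, characterExtension_inr]

theorem character_star_mul_self (χ : characterSpace ℂ A) (a : A) :
    χ (star a * a) = ((‖χ a‖ ^ 2 : ℝ) : ℂ) := by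
  rw [map_mul, character_star]
  simpa using Complex.conj_mul' (χ a)

theorem isInducing_characterExtension :
    Topology.IsInducing (characterExtension : characterSpace ℂ A → _) := by
  have h1 : Continuous (characterExtension : characterSpace ℂ A → _) := by
    refine Continuous.subtype_mk (WeakDual.continuous_of_continuous_eval fun x => ?_) _
    exact (continuous_const.add (continuous_character_apply x.snd)).congr
      fun χ => (characterExtension_apply χ x).symm
  have h2 : Continuous fun (Φ : characterSpace ℂ (Unitization ℂ A)) (a : A) =>
      Φ (a : Unitization ℂ A) :=
    continuous_pi fun a => (eval_continuous _).comp continuous_subtype_val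
  refine Topology.IsInducing.of_comp h1 h2 ?_
  have h3 : Topology.IsInducing fun (φ : WeakDual ℂ A) (a : A) => φ a := ⟨rfl⟩
  convert h3.comp Topology.IsInducing.subtypeVal using 1
  exact funext₂ characterExtension_inr

/-- Continuous functions on the spectrum of the unitization vanishing at infinity come from
elements of the algebra. -/
theorem exists_forall_character_eq (F : C(characterSpace ℂ (Unitization ℂ A), ℂ))
    (hF : F (characterAtInfinity A) = 0) :
    ∃ a : A, ∀ χ : characterSpace ℂ A, χ a = F (characterExtension χ) := by
  obtain ⟨z, rfl⟩ := (gelfandTransform_bijective (Unitization ℂ A)).2 F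
  have hz : z.fst = 0 := hF
  refine ⟨z.snd, fun χ => ?_⟩
  change χ z.snd = characterExtension χ z
  rw [characterExtension_apply, hz, zero_add]

theorem exists_forall_character_eq_comp_re (h : A) {g : ℝ → ℝ} (hg : Continuous g) (h0 : g 0 = 0) :
    ∃ a : A, ∀ χ : characterSpace ℂ A, χ a = (g (χ h).re : ℂ) := by
  obtain ⟨a, ha⟩ := exists_forall_character_eq (A := A)
    ⟨fun Φ => (g (Φ (h : Unitization ℂ A)).re : ℂ), by
      have : Continuous fun Φ : characterSpace ℂ (Unitization ℂ A) => Φ (h : Unitization ℂ A) :=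
        (eval_continuous _).comp continuous_subtype_val
      exact Complex.continuous_ofReal.comp (hg.comp (Complex.continuous_re.comp this))⟩
    (by simp [characterAtInfinity_apply, h0])
  exact ⟨a, fun χ => by simpa using ha χ⟩

/-- Urysohn's lemma in the compact spectrum of the unitization, with the point at infinity put into
the zero set so that the function comes from `A`. -/
theorem exists_character_eq_one_of_mem_isOpen {U : Set (characterSpace ℂ A)} (hU : IsOpen U)
    {χ : characterSpace ℂ A} (hχ : χ ∈ U) :
    ∃ a : A, χ a = 1 ∧ ∀ ψ : characterSpace ℂ A, ψ ∉ U → ψ a = 0 := by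
  obtain ⟨V, hV, rfl⟩ := isInducing_characterExtension.isOpen_iff.1 hU
  have hd : Disjoint (V ∩ {characterAtInfinity A}ᶜ)ᶜ {characterExtension χ} :=
    Set.disjoint_singleton_right.2 fun h =>
      h ⟨hχ, characterExtension_ne_characterAtInfinity χ⟩
  obtain ⟨f, hf0, hf1, -⟩ := exists_continuous_zero_one_of_isClosed
    (hV.inter isOpen_compl_singleton).isClosed_compl isClosed_singleton hd
  obtain ⟨a, ha⟩ := exists_forall_character_eq (A := A)
    ⟨fun Φ => (f Φ : ℂ), by fun_prop⟩ (by simpa using hf0 (by simp))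
  refine ⟨a, ?_, fun ψ hψ => ?_⟩
  · simpa [hf1 rfl] using ha χ
  · have : f (characterExtension ψ) = 0 := hf0 (fun h => hψ h.1)
    simpa [this] using ha ψ

/-- The corresponding set for the unitization is closed in a compact space, and it avoids the point
at infinity because `ε > 0`. -/
theorem isCompact_le_norm_character (a : A) {ε : ℝ} (hε : 0 < ε) :
    IsCompact {χ : characterSpace ℂ A | ε ≤ ‖χ a‖} := by
  have hc : Continuous fun Φ : characterSpace ℂ (Unitization ℂ A) => Φ (a : Unitization ℂ A) :=
    (eval_continuous _).comp continuous_subtype_val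
  have hK : IsCompact {Φ : characterSpace ℂ (Unitization ℂ A) | ε ≤ ‖Φ (a : Unitization ℂ A)‖} :=
    (isClosed_le continuous_const hc.norm).isCompact
  have := isInducing_characterExtension.isCompact_preimage' hK (fun Φ hΦ => by
    obtain ⟨χ, rfl⟩ := exists_characterExtension_eq Φ (a := a)
      (norm_pos_iff.1 (hε.trans_le hΦ))
    exact ⟨χ, rfl⟩)
  simpa using this

/-- Used to pass from σ-compactness to paracompactness. -/
instance : WeaklyLocallyCompactSpace (characterSpace ℂ A) where
  exists_compact_mem_nhds χ := by
    obtain ⟨a, ha⟩ := exists_character_apply_ne_zero χ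
    have hp : 0 < ‖χ a‖ := norm_pos_iff.2 ha
    refine ⟨_, isCompact_le_norm_character a (half_pos hp), ?_⟩
    filter_upwards [(continuous_character_apply a).norm.tendsto χ |>.eventually
      (lt_mem_nhds (half_lt_self hp))] with ψ hψ using hψ.le

end Characters

/-! ### Sequences without common zero, covering properties and strict positivity -/

section StrictPositivity

variable {A : Type u} [NonUnitalCommCStarAlgebra A]

theorem exists_hasSum_smul_star_mul_self (c : ℕ → A) :
    ∃ (w : ℕ → ℝ) (h : A), (∀ n, 0 < w n) ∧ ‖h‖ ≤ 1 ∧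
      HasSum (fun n => (w n : ℂ) • (star (c n) * c n)) h := by
  -- These weights give the terms norm at most $2^{-(n+1)}$, so the sum lies in the unit ball.
  have hw (n : ℕ) : 0 < (1 / 2 : ℝ) * (1 / 2) ^ n / (1 + ‖c n‖ ^ 2) := by positivity
  have hb (n : ℕ) : ‖(((1 / 2 : ℝ) * (1 / 2) ^ n / (1 + ‖c n‖ ^ 2) : ℝ) : ℂ) •
      (star (c n) * c n)‖ ≤ (1 / 2) * (1 / 2) ^ n := by
    rw [norm_smul, CStarRing.norm_star_mul_self, Complex.norm_real, Real.norm_eq_abs,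
      abs_of_pos (hw n), div_mul_eq_mul_div, div_le_iff₀ (by positivity)]
    gcongr
    nlinarith
  have hs : HasSum (fun n : ℕ => (1 / 2 : ℝ) * (1 / 2) ^ n) 1 := by
    simpa using hasSum_geometric_two.mul_left (1 / 2 : ℝ)
  have hsum := Summable.of_norm_bounded hs.summable hb
  exact ⟨_, _, hw, tsum_of_norm_bounded hs hb, hsum.hasSum⟩

theorem hasSum_character_of_hasSum_smul_star_mul_self {c : ℕ → A} {w : ℕ → ℝ} {h : A}
    (hs : HasSum (fun n => (w n : ℂ) • (star (c n) * c n)) h) (χ : characterSpace ℂ A) :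
    HasSum (fun n => w n * ‖χ (c n)‖ ^ 2) (χ h).re ∧ χ h = ((χ h).re : ℂ) := by
  have h1 : HasSum (fun n => ((w n * ‖χ (c n)‖ ^ 2 : ℝ) : ℂ)) (χ h) := by
    have := hs.map χ (map_continuous χ)
    convert this using 2 with n
    rw [Function.comp_apply, map_smul, character_star_mul_self]
    push_cast; rfl
  have h2 : HasSum (fun n => w n * ‖χ (c n)‖ ^ 2) (χ h).re := by
    simpa only [Complex.ofReal_re] using Complex.hasSum_re h1
  exact ⟨h2, h1.unique (Complex.hasSum_ofReal.2 h2)⟩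

/-- A sequence in a commutative C⋆-algebra can be replaced by a single element of the unit ball
which is nonnegative on characters and has the same common zeros. -/
theorem exists_character_eq_zero_iff (c : ℕ → A) :
    ∃ h : A, ‖h‖ ≤ 1 ∧ ∀ χ : characterSpace ℂ A,
      χ h = ((χ h).re : ℂ) ∧ 0 ≤ (χ h).re ∧ (χ h = 0 ↔ ∀ n, χ (c n) = 0) := by
  obtain ⟨w, h', hw, hn, hs⟩ := exists_hasSum_smul_star_mul_self c
  refine ⟨h', hn, fun χ => ?_⟩
  obtain ⟨h1, h2⟩ := hasSum_character_of_hasSum_smul_star_mul_self hs χ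
  have h0 (n : ℕ) : 0 ≤ w n * ‖χ (c n)‖ ^ 2 := mul_nonneg (hw n).le (sq_nonneg _)
  refine ⟨h2, h1.nonneg h0, fun h => ?_, fun h => ?_⟩
  · rw [h, Complex.zero_re, hasSum_zero_iff_of_nonneg h0] at h1
    intro n
    simpa [(hw n).ne'] using congrFun h1 n
  · simp only [h, norm_zero] at h1
    have h3 : (χ h').re = 0 := h1.unique (by simp [hasSum_zero])
    rw [h2, h3, Complex.ofReal_zero]

theorem exists_eq_star_mul_self {h : A}
    (hh : ∀ χ : characterSpace ℂ A, χ h = ((χ h).re : ℂ) ∧ 0 ≤ (χ h).re) :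
    ∃ b : A, h = star b * b := by
  obtain ⟨b, hb⟩ := exists_forall_character_eq_comp_re h Real.continuous_sqrt Real.sqrt_zero
  refine ⟨b, eq_of_forall_character fun χ => ?_⟩
  rw [character_star_mul_self, hb, Complex.norm_real, Real.norm_eq_abs, sq_abs,
    Real.sq_sqrt (hh χ).2, ← (hh χ).1]

/-- A sequence of elements of `A` without common zero on the spectrum of `A`. -/
def HasSeqWithoutCommonZero (A : Type u) [NonUnitalCommCStarAlgebra A] : Prop :=
  ∃ c : ℕ → A, ∀ χ : characterSpace ℂ A, ∃ n, χ (c n) ≠ 0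

theorem hasSeqWithoutCommonZero_of_countable {S : Set A} (hS : S.Countable)
    (h : ∀ χ : characterSpace ℂ A, ∃ a ∈ S, χ a ≠ 0) : HasSeqWithoutCommonZero A := by
  rcases S.eq_empty_or_nonempty with rfl | hne
  · exact ⟨0, fun χ => absurd (h χ) (by simp)⟩
  · obtain ⟨c, rfl⟩ := hS.exists_eq_range hne
    exact ⟨c, fun χ => by simpa using h χ⟩

theorem isSigmaCompact_character_ne_zero (a : A) :
    IsSigmaCompact {χ : characterSpace ℂ A | χ a ≠ 0} := by
  refine ⟨fun n : ℕ => {χ | 1 / ((n : ℝ) + 1) ≤ ‖χ a‖},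
    fun n => isCompact_le_norm_character a (by positivity), ?_⟩
  ext χ
  simp only [Set.mem_iUnion, Set.mem_ofPred_eq]
  refine ⟨fun ⟨n, hn⟩ => norm_pos_iff.1 (lt_of_lt_of_le (by positivity) hn), fun h => ?_⟩
  obtain ⟨n, hn⟩ := exists_nat_one_div_lt (norm_pos_iff.2 h)
  exact ⟨n, hn.le⟩

theorem isOpen_character_ne_zero (a : A) : IsOpen {χ : characterSpace ℂ A | χ a ≠ 0} :=
  isOpen_ne.preimage (continuous_character_apply a)

theorem HasSeqWithoutCommonZero.sigmaCompactSpace (h : HasSeqWithoutCommonZero A) :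
    SigmaCompactSpace (characterSpace ℂ A) := by
  obtain ⟨c, hc⟩ := h
  rw [← isSigmaCompact_univ_iff]
  convert isSigmaCompact_iUnion _ fun n => isSigmaCompact_character_ne_zero (c n)
  ext χ
  simpa using hc χ

theorem hasSeqWithoutCommonZero_of_lindelofSpace [LindelofSpace (characterSpace ℂ A)] :
    HasSeqWithoutCommonZero A := by
  obtain ⟨S, hS, hcov⟩ := isLindelof_univ.elim_countable_subcover
    (fun a : A => {χ : characterSpace ℂ A | χ a ≠ 0}) isOpen_character_ne_zero
    (fun χ _ => Set.mem_iUnion.2 (exists_character_apply_ne_zero χ))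
  exact hasSeqWithoutCommonZero_of_countable hS fun χ => by
    simpa using hcov (Set.mem_univ χ)

/-- An element with trivial annihilator vanishes at no open set of characters. -/
theorem dense_character_ne_zero {a₀ : A} (ha₀ : ∀ b : A, b * a₀ = 0 → b = 0) :
    Dense {χ : characterSpace ℂ A | χ a₀ ≠ 0} := by
  rw [dense_iff_inter_open]
  rintro U hU ⟨χ, hχ⟩
  obtain ⟨b, hb1, hb0⟩ := exists_character_eq_one_of_mem_isOpen hU hχ
  by_contra hempty
  have : b = 0 := ha₀ b <| eq_of_forall_character fun ψ => by
    rw [map_mul, map_zero, mul_eq_zero]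
    by_contra! h
    exact hempty ⟨ψ, not_not.1 fun hψ => h.1 (hb0 ψ hψ), h.2⟩
  simp [this] at hb1

/-- Refine the cover by the sets $\{a\ne0\}$ to a locally finite one. Each nonempty member meets the
dense set $\{a_0\ne0\}=\bigcup_n K_n$, and each compact $K_n$ meets only finitely many members. -/
theorem hasSeqWithoutCommonZero_of_paracompactSpace [ParacompactSpace (characterSpace ℂ A)]
    {a₀ : A} (ha₀ : ∀ b : A, b * a₀ = 0 → b = 0) : HasSeqWithoutCommonZero A := by
  obtain ⟨V, hVo, hVc, hVf, hVs⟩ := precise_refinement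
    (fun a : A => {χ : characterSpace ℂ A | χ a ≠ 0}) isOpen_character_ne_zero
    (Set.iUnion_eq_univ_iff.2 exists_character_apply_ne_zero)
  obtain ⟨K, hK, hKu⟩ := isSigmaCompact_character_ne_zero a₀
  refine hasSeqWithoutCommonZero_of_countable
    (S := ⋃ n, {a | (V a ∩ K n).Nonempty})
    (Set.countable_iUnion fun n => (hVf.finite_nonempty_inter_compact (hK n)).countable)
    fun χ => ?_
  obtain ⟨a, ha⟩ := Set.mem_iUnion.1 (hVc.ge (Set.mem_univ χ))
  obtain ⟨ψ, hψV, hψ⟩ := (dense_character_ne_zero ha₀).inter_open_nonempty _ (hVo a) ⟨χ, ha⟩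
  rw [← hKu] at hψ
  obtain ⟨n, hn⟩ := Set.mem_iUnion.1 hψ
  exact ⟨a, Set.mem_iUnion.2 ⟨n, ψ, hψV, hn⟩, hVs a ha⟩

theorem IsStrictlyPositiveElement.hasSeqWithoutCommonZero {h : A}
    (hh : IsStrictlyPositiveElement h) : HasSeqWithoutCommonZero A := by
  refine ⟨fun _ => h, fun χ => ⟨0, (hh.2 (CharacterSpace.toCLM χ) (fun a => ?_) χ.2.1).ne'⟩⟩
  rw [CharacterSpace.coe_toCLM, character_star_mul_self]
  exact Complex.zero_le_real.2 (sq_nonneg _)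

/-- The degenerate case of Cauchy–Schwarz: $f((x+ty)^*(x+ty))$ has no quadratic term in $t$, and a
nonnegative affine function on a real line is constant. The lines $t=r$ and $t=ir$ are both needed.
-/
theorem apply_star_mul_eq_zero {f : A →L[ℂ] ℂ} (hf : ∀ a : A, 0 ≤ f (star a * a)) {y : A}
    (hy : f (star y * y) = 0) (x : A) : f (star x * y) = 0 := by
  have key (t : ℂ) : 0 ≤ f (star x * x) + t * f (star x * y) + star t * f (star y * x) := by
    convert hf (x + t • y) using 1
    simp [star_add, star_smul, add_mul, mul_add, mul_smul_comm, smul_mul_assoc, hy]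
    ring
  have hlin : ∀ p z : ℂ, 0 ≤ p → (∀ r : ℝ, 0 ≤ p + r * z) → z = 0 := by
    intro p z hp h
    rw [Complex.nonneg_iff] at hp
    have h' (r : ℝ) := Complex.nonneg_iff.1 (h r)
    simp only [Complex.add_re, Complex.add_im, Complex.re_ofReal_mul, Complex.im_ofReal_mul] at h'
    apply Complex.ext
    · by_contra hz
      have := (h' (-(p.re + 1) / z.re)).1
      rw [div_mul_cancel₀ _ hz] at this
      linarith
    · have := (h' 1).2
      simp only [one_mul, ← hp.2, zero_add] at this
      exact this.symm
  have h1 := hlin _ (f (star x * y) + f (star y * x)) (hf x) fun r => by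
    simpa [mul_add, add_assoc] using key r
  have h2 := hlin _ (Complex.I * (f (star x * y) - f (star y * x))) (hf x) fun r => by
    convert key (r * Complex.I) using 1
    simp
    ring
  have h3 : f (star x * y) - f (star y * x) = 0 := by simpa using h2
  linear_combination (h1 + h3) / 2

/-- Take $h=\sum w_n e_n^*e_n$. If $f(h)=0$, then each $f(e_n^*e_n)=0$, hence $f(ae_n)=0$ by
Cauchy–Schwarz, and $f(a)=0$ in the limit. -/
theorem HasSequentialApproxIdentity.exists_isStrictlyPositiveElement
    (hA : HasSequentialApproxIdentity A) : ∃ h : A, IsStrictlyPositiveElement h := by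
  obtain ⟨e, -, he⟩ := hA
  obtain ⟨w, h, hw, -, hs⟩ := exists_hasSum_smul_star_mul_self e
  have hb : ∃ b : A, h = star b * b := exists_eq_star_mul_self fun χ => by
    obtain ⟨h1, h2⟩ := hasSum_character_of_hasSum_smul_star_mul_self hs χ
    exact ⟨h2, h1.nonneg fun n => mul_nonneg (hw n).le (sq_nonneg _)⟩
  refine ⟨h, hb, fun f hf hf0 => ?_⟩
  obtain ⟨b, hb⟩ := hb
  refine lt_of_le_of_ne (hb ▸ hf b) fun h0 => hf0 ?_
  have hsf := hs.map f f.continuous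
  have hterm (n : ℕ) : 0 ≤ (f ∘ fun n => (w n : ℂ) • (star (e n) * e n)) n := by
    simp only [Function.comp_apply, map_smul, smul_eq_mul]
    exact mul_nonneg (by exact_mod_cast (hw n).le) (hf _)
  rw [← h0, hasSum_zero_iff_of_nonneg hterm] at hsf
  have he0 (n : ℕ) : f (star (e n) * e n) = 0 := by
    simpa [(hw n).ne'] using congrFun hsf n
  ext a
  have hlim := (f.continuous.tendsto a).comp (he a).1
  refine tendsto_nhds_unique hlim ?_
  have (n : ℕ) : f (a * e n) = 0 := by
    simpa using apply_star_mul_eq_zero hf (he0 n) (star a)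
  simp [Function.comp_def, this]

end StrictPositivity

/-! ### Dyadic cutoff functions -/

section Cutoff

/-- A piecewise linear cutoff function, zero for `t ≤ 2 / 2 ^ n` and one for `t ≥ 3 / 2 ^ n`. -/
noncomputable def cutoff (n : ℕ) (t : ℝ) : ℝ := max 0 (min 1 (2 ^ n * t - 2))

theorem continuous_cutoff (n : ℕ) : Continuous (cutoff n) := by
  unfold cutoff
  fun_prop

theorem cutoff_zero_right (n : ℕ) : cutoff n 0 = 0 := by simp [cutoff]

theorem cutoff_nonneg (n : ℕ) (t : ℝ) : 0 ≤ cutoff n t := le_max_left _ _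

theorem cutoff_le_one (n : ℕ) (t : ℝ) : cutoff n t ≤ 1 := max_le zero_le_one (min_le_left _ _)

theorem cutoff_one_left {t : ℝ} (ht : t ≤ 1) : cutoff 1 t = 0 :=
  max_eq_left ((min_le_right _ _).trans (by linarith))

theorem cutoff_eq_one {n : ℕ} {t : ℝ} (h : 3 ≤ 2 ^ n * t) : cutoff n t = 1 := by
  rw [cutoff, min_eq_left (by linarith), max_eq_right zero_le_one]

/-- The scale doubles: $2^nt>2$ gives $2^{n+1}t>4\ge3$. -/
theorem cutoff_succ_eq_one {n : ℕ} {t : ℝ} (h : cutoff n t ≠ 0) : cutoff (n + 1) t = 1 := by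
  refine cutoff_eq_one ?_
  by_contra! h'
  refine h (max_eq_left ((min_le_right _ _).trans ?_))
  rw [pow_succ] at h'
  linarith

theorem monotone_cutoff (t : ℝ) : Monotone fun n => cutoff n t :=
  monotone_nat_of_le_succ fun n => by
    by_cases h : cutoff n t = 0
    · rw [h]; exact cutoff_nonneg _ _
    · rw [cutoff_succ_eq_one h]; exact cutoff_le_one _ _

/-- The wider difference equals one wherever the narrower one is nonzero. This makes `φ ∘ ψ`
telescope in the construction of the section. -/
theorem cutoff_sub_mul_cutoff_sub (n : ℕ) (t : ℝ) :
    (cutoff (n + 2) t - cutoff (n + 1) t) * (cutoff (n + 3) t - cutoff n t) =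
      cutoff (n + 2) t - cutoff (n + 1) t := by
  by_cases h0 : cutoff n t = 0
  · by_cases h2 : cutoff (n + 2) t = 0
    · have h1 : cutoff (n + 1) t = 0 :=
        le_antisymm ((monotone_cutoff t (Nat.le_succ (n + 1))).trans h2.le) (cutoff_nonneg _ _)
      simp [h1, h2]
    · rw [cutoff_succ_eq_one h2, h0, sub_zero, mul_one]
  · have h1 := cutoff_succ_eq_one h0
    have h2 := cutoff_succ_eq_one (h1 ▸ one_ne_zero : cutoff (n + 1) t ≠ 0)
    rw [h1, h2]; simp

end Cutoff

/-! ### The approximate identity made of cutoffs -/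

section ApproxIdentity

variable {A : Type u} [NonUnitalCommCStarAlgebra A]

/-- A sequence without common zeros yields an element `h` of the unit ball, strictly positive on
characters, whose cutoffs form an approximate identity. -/
theorem HasSeqWithoutCommonZero.exists_cutoff_approxIdentity (hA : HasSeqWithoutCommonZero A) :
    ∃ (h : A) (e : ℕ → A), ‖h‖ ≤ 1 ∧
      (∀ (n : ℕ) (χ : characterSpace ℂ A), χ (e n) = (cutoff n (χ h).re : ℂ)) ∧
      ∀ a : A, Tendsto (fun n => a * e n) atTop (𝓝 a) := by
  obtain ⟨c, hc⟩ := hA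
  obtain ⟨h, hn, hh⟩ := exists_character_eq_zero_iff c
  have hpos (χ : characterSpace ℂ A) : 0 < (χ h).re := by
    refine lt_of_le_of_ne (hh χ).2.1 fun h0 => ?_
    obtain ⟨n, hn⟩ := hc χ
    exact hn ((hh χ).2.2.1 (by rw [(hh χ).1, ← h0, Complex.ofReal_zero]) n)
  choose e he using fun n =>
    exists_forall_character_eq_comp_re h (continuous_cutoff n) (cutoff_zero_right n)
  refine ⟨h, e, hn, he, fun a => Metric.tendsto_atTop.2 fun ε hε => ?_⟩
  have hK := isCompact_le_norm_character a (half_pos hε)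
  obtain ⟨δ, hδ, hδK⟩ : ∃ δ > 0, ∀ χ : characterSpace ℂ A, ε / 2 ≤ ‖χ a‖ → δ ≤ (χ h).re := by
    rcases {χ : characterSpace ℂ A | ε / 2 ≤ ‖χ a‖}.eq_empty_or_nonempty with h0 | h0
    · exact ⟨1, one_pos, fun χ hχ => absurd hχ (Set.eq_empty_iff_forall_notMem.1 h0 χ)⟩
    · obtain ⟨χ₀, -, hχ₀⟩ := hK.exists_isMinOn h0
        (Complex.continuous_re.comp (continuous_character_apply h)).continuousOn
      exact ⟨_, hpos χ₀, fun χ hχ => hχ₀ hχ⟩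
  obtain ⟨N, hN⟩ := pow_unbounded_of_one_lt (3 / δ) (one_lt_two (α := ℝ))
  refine ⟨N, fun n hNn => ?_⟩
  rw [dist_eq_norm]
  refine (norm_le_of_forall_character (half_pos hε).le fun χ => ?_).trans_lt (half_lt_self hε)
  rw [map_sub, map_mul, he]
  -- Where $|a|$ is large, $h\ge\delta$ and the cutoff is already one; elsewhere
  -- $|a(1-e_n)|\le|a|<\varepsilon/2$.
  by_cases hχ : ε / 2 ≤ ‖χ a‖
  · rw [cutoff_eq_one]
    · simpa using (half_pos hε).le
    · rw [div_lt_iff₀ hδ] at hN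
      have h2 : (2 : ℝ) ^ N ≤ 2 ^ n := pow_le_pow_right₀ one_le_two hNn
      calc (3 : ℝ) ≤ 2 ^ N * δ := hN.le
        _ ≤ 2 ^ n * (χ h).re := by gcongr; exact hδK χ hχ
  · push Not at hχ
    have h1 : χ a * (cutoff n (χ h).re : ℂ) - χ a =
        -(χ a * ((1 - cutoff n (χ h).re : ℝ) : ℂ)) := by push_cast; ring
    rw [h1, norm_neg, norm_mul, Complex.norm_real, Real.norm_eq_abs,
      abs_of_nonneg (sub_nonneg.2 (cutoff_le_one _ _))]
    exact (mul_le_of_le_one_right (norm_nonneg _)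
      (by linarith [cutoff_nonneg n (χ h).re])).trans hχ.le

theorem HasSeqWithoutCommonZero.hasSequentialApproxIdentity (hA : HasSeqWithoutCommonZero A) :
    HasSequentialApproxIdentity A := by
  obtain ⟨h, e, -, he, hlim⟩ := hA.exists_cutoff_approxIdentity
  refine ⟨e, fun n => norm_le_of_forall_character zero_le_one fun χ => ?_,
    fun a => ⟨hlim a, by simpa only [mul_comm] using hlim a⟩⟩
  rw [he, Complex.norm_real, Real.norm_eq_abs, abs_of_nonneg (cutoff_nonneg _ _)]
  exact cutoff_le_one _ _

end ApproxIdentity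

/-! ### Averaging bilinear maps over signs -/

section Averaging

variable {ι E F G : Type*} [NormedAddCommGroup E] [NormedSpace ℂ E] [NormedAddCommGroup F]
  [NormedSpace ℂ F] [NormedAddCommGroup G] [NormedSpace ℂ G]

theorem norm_add_smul_add_sum_le_of_insert [DecidableEq ι] {i : ι} {s : Finset ι} (hi : i ∉ s)
    {x : ι → E} {z : E} {C : ℝ}
    (h : ∀ ε : ι → ℝ, (∀ i, |ε i| ≤ 1) → ‖z + ∑ i ∈ insert i s, (ε i : ℂ) • x i‖ ≤ C)
    (δ : ℝ) (hδ : |δ| ≤ 1) (ε : ι → ℝ) (hε : ∀ i, |ε i| ≤ 1) :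
    ‖(z + (δ : ℂ) • x i) + ∑ i ∈ s, (ε i : ℂ) • x i‖ ≤ C := by
  convert h (Function.update ε i δ) (fun j => ?_) using 2
  · rw [Finset.sum_insert hi, Function.update_self, add_assoc]
    congr 2
    refine Finset.sum_congr rfl fun j hj => ?_
    rw [Function.update_of_ne (ne_of_mem_of_not_mem hj hi)]
  · by_cases hj : j = i
    · subst hj; simpa using hδ
    · simpa [Function.update_of_ne hj] using hε j

/-- Averaging over signs: a diagonal sum of values of a bilinear map is bounded through the norms
of all the signed sums of its arguments. -/
theorem norm_add_sum_bilinear_le (B : E →L[ℂ] F →L[ℂ] G) (x : ι → E) (y : ι → F) {C D : ℝ}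
    (s : Finset ι) (z : E) (w : F)
    (hx : ∀ ε : ι → ℝ, (∀ i, |ε i| ≤ 1) → ‖z + ∑ i ∈ s, (ε i : ℂ) • x i‖ ≤ C)
    (hy : ∀ ε : ι → ℝ, (∀ i, |ε i| ≤ 1) → ‖w + ∑ i ∈ s, (ε i : ℂ) • y i‖ ≤ D) :
    ‖B z w + ∑ i ∈ s, B (x i) (y i)‖ ≤ ‖B‖ * C * D := by
  classical
  induction s using Finset.induction_on generalizing z w with
  | empty =>
    have hx' := hx 0 (by simp)
    have hy' := hy 0 (by simp)
    simp only [Finset.sum_empty, add_zero] at hx' hy' ⊢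
    have hC : 0 ≤ C := (norm_nonneg _).trans hx'
    exact (B.le_opNorm₂ z w).trans (by gcongr)
  | insert i s hi ih =>
    have h1 := ih _ _ (norm_add_smul_add_sum_le_of_insert hi hx 1 (by simp))
      (norm_add_smul_add_sum_le_of_insert hi hy 1 (by simp))
    have h2 := ih _ _ (norm_add_smul_add_sum_le_of_insert hi hx (-1) (by simp))
      (norm_add_smul_add_sum_le_of_insert hi hy (-1) (by simp))
    -- Averaging over the sign of the `i`-th terms cancels the mixed products and keeps `B (x i) (y
    -- i)`.
    have key : B z w + ∑ i ∈ insert i s, B (x i) (y i) = (2⁻¹ : ℂ) •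
        ((B (z + ((1 : ℝ) : ℂ) • x i) (w + ((1 : ℝ) : ℂ) • y i) + ∑ i ∈ s, B (x i) (y i)) +
        (B (z + ((-1 : ℝ) : ℂ) • x i) (w + ((-1 : ℝ) : ℂ) • y i) + ∑ i ∈ s, B (x i) (y i))) := by
      rw [Finset.sum_insert hi]
      simp only [Complex.ofReal_one, Complex.ofReal_neg, one_smul, neg_smul, map_add, map_neg,
        add_apply, neg_apply]
      module
    rw [key, norm_smul, show ‖(2⁻¹ : ℂ)‖ = 2⁻¹ by simp]
    have := norm_add_le_of_le h1 h2
    linarith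

end Averaging

/-! ### Second cohomology and split extensions of left modules -/

section Cohomology

theorem subsingleton_H₂_iff {A : Type u} [NonUnitalNormedRing A] [NormedSpace ℂ A]
    {X : Type v} [NormedAddCommGroup X] [NormedSpace ℂ X] (M : Bimodule A X) : Subsingleton M.H₂ ↔
      M.cocycles₂ ≤ M.coboundaries₂ :=
  Submodule.Quotient.subsingleton_iff.trans Submodule.submoduleOf_eq_top

variable {A : Type u} [NonUnitalNormedRing A] [NormedSpace ℂ A]
  [IsScalarTower ℂ A A] [SMulCommClass ℂ A A]

/-- The extension of the left module `A` by `X` determined by a bounded bilinear map satisfying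
the cocycle identity. -/
noncomputable def LeftModule.extension {X : Type v} [NormedAddCommGroup X] [NormedSpace ℂ X]
    (M : LeftModule A X) (f : A →L[ℂ] A →L[ℂ] X)
    (hf : ∀ a b c : A, M.lact a (f b c) - f (a * b) c + f a (b * c) = 0) :
    LeftModule A (X × A) where
  lact := LinearMap.mkContinuous₂
    (LinearMap.mk₂ ℂ (fun a p => (M.lact a p.1 + f a p.2, a * p.2))
      (fun a b p => by simp [add_mul, add_add_add_comm])
      (fun r a p => by simp [smul_mul_assoc])
      (fun a p q => by simp [mul_add, add_add_add_comm])
      (fun r a p => by simp [mul_smul_comm]))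
    (‖M.lact‖ + ‖f‖ + 1) (fun a p => by
      have h1 : ‖p.1‖ ≤ ‖p‖ := norm_fst_le p
      have h2 : ‖p.2‖ ≤ ‖p‖ := norm_snd_le p
      refine (norm_prod_le_iff).2 ⟨?_, ?_⟩
      · calc ‖M.lact a p.1 + f a p.2‖ ≤ ‖M.lact‖ * ‖a‖ * ‖p.1‖ + ‖f‖ * ‖a‖ * ‖p.2‖ :=
              norm_add_le_of_le (M.lact.le_opNorm₂ _ _) (f.le_opNorm₂ _ _)
          _ ≤ ‖M.lact‖ * ‖a‖ * ‖p‖ + ‖f‖ * ‖a‖ * ‖p‖ := by gcongr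
          _ ≤ (‖M.lact‖ + ‖f‖ + 1) * ‖a‖ * ‖p‖ := by
            have : 0 ≤ ‖a‖ * ‖p‖ := by positivity
            linarith
      · calc ‖a * p.2‖ ≤ ‖a‖ * ‖p‖ := (norm_mul_le _ _).trans (by gcongr)
          _ ≤ (‖M.lact‖ + ‖f‖ + 1) * ‖a‖ * ‖p‖ := by
            have : 0 ≤ (‖M.lact‖ + ‖f‖) * (‖a‖ * ‖p‖) := by positivity
            linarith)
  mul_lact a b p := by
    refine Prod.ext ?_ (mul_assoc a b p.2)
    have h := hf a b p.2
    change M.lact (a * b) p.1 + f (a * b) p.2 =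
      M.lact a (M.lact b p.1 + f b p.2) + f a (b * p.2)
    rw [M.mul_lact, map_add, ← sub_eq_zero, ← neg_eq_zero, ← h]
    abel

theorem LeftModule.extension_lact {X : Type v} [NormedAddCommGroup X] [NormedSpace ℂ X]
    (M : LeftModule A X) (f : A →L[ℂ] A →L[ℂ] X)
    (hf : ∀ a b c : A, M.lact a (f b c) - f (a * b) c + f a (b * c) = 0) (a : A) (p : X × A) :
    (M.extension f hf).lact a p = (M.lact a p.1 + f a p.2, a * p.2) := rfl

/-- A module section of the extension $X\times\mathcal A\to\mathcal A$ attached to a cocycle has, up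
to sign, a first component whose coboundary is that cocycle. -/
theorem IsLeftProjective.h₂VanishesOnRightAnnihilator [CompleteSpace A]
    (hA : IsLeftProjective A) : H₂VanishesOnRightAnnihilator A := by
  intro X _ _ _ M hM
  rw [subsingleton_H₂_iff]
  intro f hf
  have hf' (a b c : A) : M.lact a (f b c) - f (a * b) c + f a (b * c) = 0 := by
    have := hf a b c
    rwa [hM, sub_zero] at this
  obtain ⟨ψ, hψ, hs⟩ := hA (X × A) (M.extension f hf') (ContinuousLinearMap.snd ℂ X A)
    (fun a p => rfl) ⟨ContinuousLinearMap.inr ℂ X A, by ext; rfl⟩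
  have hψ2 (b : A) : (ψ b).2 = b := DFunLike.congr_fun hs b
  refine ⟨-((ContinuousLinearMap.fst ℂ X A) ∘L ψ), fun a b => ?_⟩
  have h := congrArg Prod.fst (hψ a b)
  rw [LeftModule.extension_lact] at h
  change (ψ (a * b)).1 = M.lact a (ψ b).1 + f a (ψ b).2 at h
  rw [hψ2] at h
  rw [hM, add_zero]
  change f a b = M.lact a (-(ψ b).1) - -(ψ (a * b)).1
  rw [h, map_neg]
  abel

/-- The kernel of a morphism of left modules, as a submodule. -/
noncomputable def LeftModule.ker {Y P : Type*} [NormedAddCommGroup Y] [NormedSpace ℂ Y]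
    [NormedAddCommGroup P] [NormedSpace ℂ P] (N : LeftModule A Y) (M : LeftModule A P)
    (φ : Y →L[ℂ] P) (hφ : IsMorphism N M φ) : LeftModule A φ.ker where
  lact := LinearMap.mkContinuous₂
    (LinearMap.mk₂ ℂ (fun a (y : φ.ker) => (⟨N.lact a y, by
        rw [LinearMap.mem_ker]
        exact (hφ a y).trans (by rw [show φ y = 0 from y.2, map_zero])⟩ : φ.ker))
      (fun a b y => Subtype.ext (by simp))
      (fun r a y => Subtype.ext (by simp))
      (fun a x y => Subtype.ext (by simp))
      (fun r a y => Subtype.ext (by simp)))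
    ‖N.lact‖ (fun a y => N.lact.le_opNorm₂ a y)
  mul_lact a b y := Subtype.ext (N.mul_lact a b y)

/-- The defect $a\cdot\sigma(b)-\sigma(ab)$ of a linear section is a cocycle in $\ker\varphi$ with
zero right action. If it is the coboundary of $g$, then $\sigma-g$ is a module section. -/
theorem H₂VanishesOnRightAnnihilator.isLeftProjective
    (hA : H₂VanishesOnRightAnnihilator A) : IsLeftProjective A := by
  rintro Y _ _ _ N φ hφ ⟨σ, hσ⟩
  have hσ' (a : A) : φ (σ a) = a := DFunLike.congr_fun hσ a
  have : CompleteSpace φ.ker := φ.isClosed_ker.completeSpace_coe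
  let M : Bimodule A φ.ker :=
    { N.ker (LeftModule.self A) φ hφ with
      ract := 0
      mul_ract := fun a b x => by simp
      lact_ract := fun a b x => by simp }
  have hM (a : A) (y : φ.ker) : (M.lact a y : Y) = N.lact a y := rfl
  let f : A →L[ℂ] A →L[ℂ] φ.ker := LinearMap.mkContinuous₂
    (LinearMap.mk₂ ℂ (fun a b => (⟨N.lact a (σ b) - σ (a * b), by
        rw [LinearMap.mem_ker]
        change φ _ = 0
        rw [map_sub, hφ, hσ', hσ']
        exact sub_self _⟩ : φ.ker))
      (fun a b c => Subtype.ext (by simp [add_mul, add_sub_add_comm]))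
      (fun r a c => Subtype.ext (by simp [smul_mul_assoc, smul_sub]))
      (fun a b c => Subtype.ext (by simp [mul_add, add_sub_add_comm]))
      (fun r a c => Subtype.ext (by simp [mul_smul_comm, smul_sub])))
    (‖N.lact‖ * ‖σ‖ + ‖σ‖) (fun a b => by
      change ‖N.lact a (σ b) - σ (a * b)‖ ≤ _
      calc _ ≤ ‖N.lact‖ * ‖a‖ * ‖σ b‖ + ‖σ‖ * ‖a * b‖ :=
            norm_sub_le_of_le (N.lact.le_opNorm₂ _ _) (σ.le_opNorm _)
        _ ≤ ‖N.lact‖ * ‖a‖ * (‖σ‖ * ‖b‖) + ‖σ‖ * (‖a‖ * ‖b‖) := by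
            gcongr
            · exact σ.le_opNorm _
            · exact norm_mul_le _ _
        _ = _ := by ring)
  have hf (a b : A) : (f a b : Y) = N.lact a (σ b) - σ (a * b) := rfl
  have hcocycle : f ∈ M.cocycles₂ := fun a b c => Subtype.ext (by
    change (M.lact a (f b c) : Y) - f (a * b) c + f a (b * c) - 0 = 0
    rw [hM, hf, hf, hf, map_sub, N.mul_lact, mul_assoc]
    abel)
  obtain ⟨g, hg⟩ := (subsingleton_H₂_iff M).1 (hA φ.ker M fun a x => rfl) hcocycle
  have hg' (a b : A) : N.lact a (σ b) - σ (a * b) = N.lact a (g b) - g (a * b) := by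
    have := congrArg Subtype.val (hg a b)
    rw [hf] at this
    rw [this]
    change (M.lact a (g b) : Y) - g (a * b) + 0 = _
    rw [add_zero, hM]
  refine ⟨σ - φ.ker.subtypeL ∘L g, fun a b => ?_, ?_⟩
  · change σ (a * b) - g (a * b) = N.lact a (σ b - g b)
    rw [map_sub, ← sub_eq_zero, ← neg_eq_zero, ← sub_eq_zero.2 (hg' a b)]
    abel
  · ext b
    change φ (σ b - g b) = b
    rw [map_sub, hσ', show φ (g b) = 0 from (g b).2, sub_zero]

end Cohomology

/-! ### Construction of a module section -/

section Projectivity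

theorem abs_sum_mul_sub_le {G : ℕ → ℝ} (hG : Monotone G) {ε : ℕ → ℝ} (hε : ∀ n, |ε n| ≤ 1)
    {N M : ℕ} (h : N ≤ M) :
    |∑ n ∈ Finset.Ico N M, ε n * (G (n + 1) - G n)| ≤ G M - G N := by
  induction M, h using Nat.le_induction with
  | base => simp
  | succ M hNM ih =>
    rw [Finset.sum_Ico_succ_top hNM]
    have h1 : 0 ≤ G (M + 1) - G M := sub_nonneg.2 (hG M.le_succ)
    have h2 : |ε M * (G (M + 1) - G M)| ≤ G (M + 1) - G M := by
      rw [abs_mul, abs_of_nonneg h1]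
      exact mul_le_of_le_one_left h1 (hε M)
    linarith [abs_add_le (∑ n ∈ Finset.Ico N M, ε n * (G (n + 1) - G n)) (ε M * (G (M + 1) - G M))]

variable {A : Type u} [NonUnitalCommCStarAlgebra A]

/-- At each character the cutoffs increase to at most one, so their variation from index $N+1$ on is
at most $1-e_{N+1}$. The bound tends to zero as $N$ grows. -/
theorem norm_sum_smul_mul_sub_le {h : A} {e : ℕ → A}
    (he : ∀ (n : ℕ) (χ : characterSpace ℂ A), χ (e n) = (cutoff n (χ h).re : ℂ))
    {ε : ℕ → ℝ} (hε : ∀ n, |ε n| ≤ 1) {N M : ℕ} (hNM : N ≤ M) (a : A) :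
    ‖∑ n ∈ Finset.Ico N M, (ε n : ℂ) • (a * (e (n + 2) - e (n + 1)))‖ ≤
      ‖a - a * e (N + 1)‖ := by
  refine norm_le_of_forall_character (norm_nonneg _) fun χ =>
    le_trans ?_ (norm_character_apply_le χ _)
  have h1 : χ (∑ n ∈ Finset.Ico N M, (ε n : ℂ) • (a * (e (n + 2) - e (n + 1)))) =
      χ a * ((∑ n ∈ Finset.Ico N M,
        ε n * (cutoff (n + 1 + 1) (χ h).re - cutoff (n + 1) (χ h).re) : ℝ) : ℂ) := by
    rw [map_sum, Complex.ofReal_sum, Finset.mul_sum]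
    refine Finset.sum_congr rfl fun n _ => ?_
    rw [map_smul, map_mul, map_sub, he, he]
    push_cast
    rw [smul_eq_mul]
    ring
  have h2 : χ (a - a * e (N + 1)) = χ a * ((1 - cutoff (N + 1) (χ h).re : ℝ) : ℂ) := by
    rw [map_sub, map_mul, he]
    push_cast
    ring
  rw [h1, h2, norm_mul, norm_mul, Complex.norm_real, Complex.norm_real, Real.norm_eq_abs,
    Real.norm_eq_abs, abs_of_nonneg (sub_nonneg.2 (cutoff_le_one _ _))]
  gcongr
  refine (abs_sum_mul_sub_le (G := fun n => cutoff (n + 1) (χ h).re)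
    (fun i j hij => monotone_cutoff _ (by lia)) hε hNM).trans ?_
  have := cutoff_le_one (M + 1) (χ h).re
  simpa using this

/-- Each $e_{n+3}-e_n$ splits into three consecutive differences, and each of the three resulting
families has total variation at most one. -/
theorem norm_sum_smul_sub_le {h : A} {e : ℕ → A}
    (he : ∀ (n : ℕ) (χ : characterSpace ℂ A), χ (e n) = (cutoff n (χ h).re : ℂ))
    {ε : ℕ → ℝ} (hε : ∀ n, |ε n| ≤ 1) {N M : ℕ} (hNM : N ≤ M) :
    ‖∑ n ∈ Finset.Ico N M, (ε n : ℂ) • (e (n + 3) - e n)‖ ≤ 3 := by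
  refine norm_le_of_forall_character (by norm_num) fun χ => ?_
  have h1 : χ (∑ n ∈ Finset.Ico N M, (ε n : ℂ) • (e (n + 3) - e n)) =
      ((∑ k ∈ Finset.range 3, ∑ n ∈ Finset.Ico N M,
        ε n * (cutoff (n + 1 + k) (χ h).re - cutoff (n + k) (χ h).re) : ℝ) : ℂ) := by
    rw [map_sum, Finset.sum_comm, Complex.ofReal_sum]
    refine Finset.sum_congr rfl fun n _ => ?_
    rw [map_smul, map_sub, he, he, Finset.sum_range_succ, Finset.sum_range_succ,
      Finset.sum_range_one]
    push_cast
    rw [smul_eq_mul]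
    simp only [add_assoc, Nat.reduceAdd, add_zero]
    ring
  have h2 (k : ℕ) : |∑ n ∈ Finset.Ico N M,
      ε n * (cutoff (n + 1 + k) (χ h).re - cutoff (n + k) (χ h).re)| ≤ 1 := by
    refine (abs_sum_mul_sub_le (G := fun n => cutoff (n + k) (χ h).re)
      (fun i j hij => monotone_cutoff _ (by lia)) hε hNM).trans ?_
    linarith [cutoff_le_one (M + k) (χ h).re, cutoff_nonneg (N + k) (χ h).re]
  rw [h1, Complex.norm_real, Real.norm_eq_abs]
  refine (Finset.abs_sum_le_sum_abs _ _).trans ((Finset.sum_le_sum fun k _ => h2 k).trans ?_)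
  simp

theorem HasSeqWithoutCommonZero.isLeftProjective (hA : HasSeqWithoutCommonZero A) :
    IsLeftProjective A := by
  obtain ⟨h, e, hn, he, hlim⟩ := hA.exists_cutoff_approxIdentity
  rintro Y _ _ _ N φ hφ ⟨σ, hσ⟩
  have hσ' (a : A) : φ (σ a) = a := DFunLike.congr_fun hσ a
  let B : A →L[ℂ] A →L[ℂ] Y := (N.lact.flip ∘L σ).flip
  have hB (x y : A) : B x y = N.lact x (σ y) := rfl
  let ψ (k : ℕ) : A →L[ℂ] Y := ∑ n ∈ Finset.range k,
    (B.flip (e (n + 3) - e n)) ∘L ((ContinuousLinearMap.mul ℂ A).flip (e (n + 2) - e (n + 1)))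
  have hψ (k : ℕ) (a : A) : ψ k a =
      ∑ n ∈ Finset.range k, B (a * (e (n + 2) - e (n + 1))) (e (n + 3) - e n) := by
    simp only [ψ, sum_apply]
    rfl
  -- Here `‖h‖ ≤ 1` is used; the telescoping sum then has no initial term.
  have he1 : e 1 = 0 := eq_of_forall_character fun χ => by
    rw [he, cutoff_one_left, map_zero, Complex.ofReal_zero]
    exact (Complex.re_le_norm _).trans ((norm_character_apply_le χ h).trans hn)
  have hmul (n : ℕ) : (e (n + 2) - e (n + 1)) * (e (n + 3) - e n) = e (n + 2) - e (n + 1) :=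
    eq_of_forall_character fun χ => by
      rw [map_mul, map_sub, map_sub, he, he, he, he]
      exact_mod_cast cutoff_sub_mul_cutoff_sub n (χ h).re
  have hφψ (k : ℕ) (a : A) : φ (ψ k a) = a * e (k + 1) := by
    rw [hψ, map_sum]
    calc ∑ n ∈ Finset.range k, φ (B (a * (e (n + 2) - e (n + 1))) (e (n + 3) - e n))
        = ∑ n ∈ Finset.range k, (a * e (n + 1 + 1) - a * e (n + 1)) := by
          refine Finset.sum_congr rfl fun n _ => ?_
          rw [hB, hφ, hσ']
          change a * (e (n + 2) - e (n + 1)) * (e (n + 3) - e n) = _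
          rw [mul_assoc, hmul, mul_sub]
      _ = a * e (k + 1) := by
          rw [Finset.sum_range_sub (fun n => a * e (n + 1)), zero_add, he1, mul_zero, sub_zero]
  have hmod (k : ℕ) (a b : A) : ψ k (a * b) = N.lact a (ψ k b) := by
    rw [hψ, hψ, map_sum]
    refine Finset.sum_congr rfl fun n _ => ?_
    rw [hB, hB, mul_assoc, N.mul_lact]
  -- Sign averaging bounds a block of the series by $\|B\|$ times a small factor from the first
  -- arguments and the constant 3 from the second.
  have hcauchy (a : A) : CauchySeq fun k => ψ k a := by
    refine cauchySeq_of_le_tendsto_0' (fun k => ‖B‖ * ‖a - a * e (k + 1)‖ * 3)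
      (fun k l hkl => ?_) ?_
    · rw [dist_comm, dist_eq_norm, hψ, hψ, ← Finset.sum_Ico_eq_sub _ hkl]
      have := norm_add_sum_bilinear_le B (fun n => a * (e (n + 2) - e (n + 1)))
        (fun n => e (n + 3) - e n) (Finset.Ico k l) 0 0
        (fun ε hε => by rw [zero_add]; exact norm_sum_smul_mul_sub_le he hε hkl a)
        (fun ε hε => by rw [zero_add]; exact norm_sum_smul_sub_le he hε hkl)
      simpa using this
    · have h1 : Tendsto (fun k => a - a * e (k + 1)) atTop (𝓝 (a - a)) :=
        tendsto_const_nhds.sub ((hlim a).comp (tendsto_add_atTop_nat 1))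
      rw [sub_self] at h1
      simpa using (h1.norm.const_mul ‖B‖).mul_const 3
  choose Ψ hΨ using fun a => cauchySeq_tendsto_of_complete (hcauchy a)
  refine ⟨continuousLinearMapOfTendsto ψ (tendsto_pi_nhds.2 hΨ), fun a b => ?_, ?_⟩
  · change Ψ (a * b) = N.lact a (Ψ b)
    refine tendsto_nhds_unique (hΨ (a * b)) ?_
    simp only [hmod]
    exact ((N.lact a).continuous.tendsto _).comp (hΨ b)
  · ext a
    change φ (Ψ a) = a
    refine tendsto_nhds_unique ((φ.continuous.tendsto _).comp (hΨ a)) ?_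
    simp only [Function.comp_def, hφψ]
    exact (hlim a).comp (tendsto_add_atTop_nat 1)

end Projectivity

/-! ### The diagonal test module: from projectivity to countability -/

section DiagonalModule

open BoundedContinuousFunction

variable (A : Type u) [NonUnitalCommCStarAlgebra A]

/-- The pairs of a bounded continuous function `F` from the spectrum of `A` to `A` and of an element
`a` of `A` such that `a` is the restriction of `F` to the diagonal. -/
def diagonalSubmodule : Submodule ℂ ((characterSpace ℂ A →ᵇ A) × A) where
  carrier := {p | ∀ χ : characterSpace ℂ A, χ (p.1 χ) = χ p.2}
  zero_mem' χ := rfl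
  add_mem' {p q} hp hq χ := by
    simp only [Prod.fst_add, Prod.snd_add, BoundedContinuousFunction.add_apply, map_add, hp χ, hq χ]
  smul_mem' r p hp χ := by
    simp only [Prod.smul_fst, Prod.smul_snd, BoundedContinuousFunction.smul_apply, map_smul, hp χ]

theorem isClosed_diagonalSubmodule : 
    IsClosed (diagonalSubmodule A : Set ((characterSpace ℂ A →ᵇ A) × A)) := by
  have : (diagonalSubmodule A : Set ((characterSpace ℂ A →ᵇ A) × A)) =
      ⋂ χ : characterSpace ℂ A, {p | χ (p.1 χ) = χ p.2} := by
    ext p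
    simp [diagonalSubmodule]
  rw [this]
  refine isClosed_iInter fun χ => isClosed_eq ?_ ?_
  · exact (map_continuous χ).comp
      ((BoundedContinuousFunction.evalCLM ℂ χ).continuous.comp continuous_fst)
  · exact (map_continuous χ).comp continuous_snd

variable {A}

/-- Multiplication of an `A`-valued function on the spectrum of `A` by the Gelfand transform of an
element of `A`. -/
noncomputable def gelfandSMul (a : A) (F : characterSpace ℂ A →ᵇ A) : characterSpace ℂ A →ᵇ A :=
  BoundedContinuousFunction.ofNormedAddCommGroup (fun χ => χ a • F χ)
    ((continuous_character_apply a).smul F.continuous) (‖a‖ * ‖F‖) fun χ => by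
      rw [norm_smul]
      gcongr
      · exact norm_character_apply_le χ a
      · exact F.norm_coe_le_norm χ

theorem gelfandSMul_apply (a : A) (F : characterSpace ℂ A →ᵇ A) (χ : characterSpace ℂ A) :
    gelfandSMul a F χ = χ a • F χ := rfl

theorem norm_gelfandSMul_le (a : A) (F : characterSpace ℂ A →ᵇ A) :
    ‖gelfandSMul a F‖ ≤ ‖a‖ * ‖F‖ :=
  BoundedContinuousFunction.norm_ofNormedAddCommGroup_le _ (by positivity) _

theorem norm_gelfandSMul_prod_le (a : A) (p : (characterSpace ℂ A →ᵇ A) × A) :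
    ‖((gelfandSMul a p.1, a * p.2) : (characterSpace ℂ A →ᵇ A) × A)‖ ≤ 1 * ‖a‖ * ‖p‖ := by
  rw [one_mul]
  refine norm_prod_le_iff.2 ⟨(norm_gelfandSMul_le _ _).trans ?_, (norm_mul_le _ _).trans ?_⟩
  · gcongr; exact norm_fst_le p
  · gcongr; exact norm_snd_le p

variable (A) in
/-- The action of `A` on pairs in `diagonalSubmodule A` through the first variable of the
functions. -/
noncomputable def diagonalAction : A →ₗ[ℂ] diagonalSubmodule A →ₗ[ℂ] diagonalSubmodule A :=
  LinearMap.mk₂ ℂ (fun a (p : diagonalSubmodule A) =>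
      (⟨(gelfandSMul a p.1.1, a * p.1.2), fun χ => by
        rw [gelfandSMul_apply, map_smul, p.2 χ, map_mul, smul_eq_mul]⟩ : diagonalSubmodule A))
      (fun a b p => Subtype.ext (Prod.ext
        (by ext χ; simp [gelfandSMul_apply, add_smul]) (add_mul _ _ _)))
      (fun r a p => Subtype.ext (Prod.ext
        (by ext χ; simp [gelfandSMul_apply, mul_smul]) (smul_mul_assoc _ _ _)))
      (fun a p q => Subtype.ext (Prod.ext
        (by ext χ; simp [gelfandSMul_apply]) (mul_add _ _ _)))
      (fun r a p => Subtype.ext (Prod.ext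
        (by ext χ; simp [gelfandSMul_apply, smul_comm r]) (mul_smul_comm _ _ _)))

theorem coe_diagonalAction (a : A) (p : diagonalSubmodule A) :
    (diagonalAction A a p : (characterSpace ℂ A →ᵇ A) × A) =
      (gelfandSMul a p.1.1, a * p.1.2) := rfl

theorem diagonalAction_mul (a b : A) (p : diagonalSubmodule A) :
    diagonalAction A (a * b) p = diagonalAction A a (diagonalAction A b p) := by
  apply Subtype.ext
  rw [coe_diagonalAction, coe_diagonalAction, coe_diagonalAction, mul_assoc]
  refine congrArg (·, _) (BoundedContinuousFunction.ext fun χ => ?_)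
  simp only [gelfandSMul_apply, map_mul, mul_smul]

variable (A) in
/-- The left Banach module of the pairs in `diagonalSubmodule A`, with `A` acting through the first
variable of the functions. -/
noncomputable def diagonalModule : LeftModule A (diagonalSubmodule A) where
  lact := (diagonalAction A).mkContinuous₂ 1 fun a p => norm_gelfandSMul_prod_le a p.1
  mul_lact a b p := diagonalAction_mul a b p

/-- Left projectivity yields a module map from `A` to continuous functions with values in `A`
that is right inverse to the restriction to the diagonal. -/
theorem IsLeftProjective.exists_diagonal_section (hA : IsLeftProjective A) :
    ∃ F : A → characterSpace ℂ A →ᵇ A, ∀ (a : A) (χ : characterSpace ℂ A),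
      χ (F a χ) = χ a ∧ ∀ b : A, F (b * a) χ = χ b • F a χ := by
  have : CompleteSpace (diagonalSubmodule A) := (isClosed_diagonalSubmodule A).completeSpace_coe
  obtain ⟨ψ, hψ, hs⟩ := hA (diagonalSubmodule A) (diagonalModule A)
    (ContinuousLinearMap.snd ℂ _ _ ∘L (diagonalSubmodule A).subtypeL) (fun a p => rfl)
    -- The linear section sends `a` to the constant function `a`; it need not respect the action,
    -- which is through the first variable.
    ⟨LinearMap.mkContinuous
      { toFun := fun a => ⟨(BoundedContinuousFunction.const _ a, a), fun χ => rfl⟩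
        map_add' := fun a b => rfl
        map_smul' := fun r a => rfl } 1 (fun a => by
          rw [one_mul]
          exact norm_prod_le_iff.2 ⟨BoundedContinuousFunction.norm_const_le a, le_rfl⟩), by
      ext a; rfl⟩
  have hs' (a : A) : (ψ a).1.2 = a := DFunLike.congr_fun hs a
  refine ⟨fun a => (ψ a).1.1, fun a χ => ⟨((ψ a).2 χ).trans (by rw [hs']), fun b => ?_⟩⟩
  have h := congrArg (fun p : diagonalSubmodule A => p.1.1 χ) (hψ b a)
  exact h

theorem IsLeftProjective.hasSeqWithoutCommonZero (hA : IsLeftProjective A)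
    {a₀ : A} (ha₀ : ∀ b : A, b * a₀ = 0 → b = 0) : HasSeqWithoutCommonZero A := by
  obtain ⟨F, hF⟩ := hA.exists_diagonal_section
  obtain ⟨K, hK, hKu⟩ := isSigmaCompact_character_ne_zero a₀
  obtain ⟨c, hc, hcK⟩ := TopologicalSpace.IsSeparable.iUnion fun n =>
    ((hK n).image (F a₀).continuous).isSeparable
  refine hasSeqWithoutCommonZero_of_countable hc fun χ => ?_
  by_contra! h0
  have hcl : closure c ⊆ {a | χ a = 0} :=
    closure_minimal h0 (isClosed_eq (map_continuous χ) continuous_const)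
  obtain ⟨b, hb⟩ := exists_character_apply_ne_zero χ
  -- Computing $F(a_0b)=F(ba_0)$ in two ways gives $s(a_0)F(b)(s)=s(b)F(a_0)(s)$. If $\chi$ kills
  -- $F(a_0)(s)$ and $s(a_0)\ne0$, it kills $F(b)(s)$; density then allows $s=\chi$, where
  -- $\chi(F(b)(\chi))=\chi(b)\ne0$.
  have hS : {s : characterSpace ℂ A | s a₀ ≠ 0} ⊆ {s | χ (F b s) = 0} := by
    intro s hs
    have h1 : χ (F a₀ s) = 0 := hcl (hcK (by
      rw [← Set.image_iUnion, hKu]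
      exact Set.mem_image_of_mem _ hs))
    have h2 : s a₀ • F b s = s b • F a₀ s := by
      rw [← (hF b s).2, ← (hF a₀ s).2, mul_comm]
    have h3 := congrArg χ h2
    rw [map_smul, map_smul, h1, smul_zero, smul_eq_zero] at h3
    exact h3.resolve_left hs
  have hcl2 := closure_minimal hS
    (isClosed_eq ((map_continuous χ).comp (F b).continuous) continuous_const)
  rw [(dense_character_ne_zero ha₀).closure_eq] at hcl2
  have h4 : χ (F b χ) = 0 := hcl2 (Set.mem_univ χ)
  exact hb ((hF b χ).1.symm.trans h4)

end DiagonalModule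

/-! ### Assembly, and the use of separability -/

/-- The equivalences for a commutative C⋆-algebra having an element with trivial annihilator. -/
theorem tfae_isLeftProjective {A : Type u} [NonUnitalCommCStarAlgebra A] {a₀ : A}
    (ha₀ : ∀ b : A, b * a₀ = 0 → b = 0) :
    List.TFAE [
      IsLeftProjective A,
      ParacompactSpace (characterSpace ℂ A),
      ∃ h : A, IsStrictlyPositiveElement h,
      SigmaCompactSpace (characterSpace ℂ A),
      LindelofSpace (characterSpace ℂ A),
      HasSequentialApproxIdentity A,
      H₂VanishesOnRightAnnihilator A] := by
  tfae_have 1 → 4 := fun h => (h.hasSeqWithoutCommonZero ha₀).sigmaCompactSpace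
  tfae_have 4 → 5 := fun _ => inferInstance
  tfae_have 5 → 6 := fun _ =>
    hasSeqWithoutCommonZero_of_lindelofSpace.hasSequentialApproxIdentity
  tfae_have 6 → 3 := fun h => h.exists_isStrictlyPositiveElement
  tfae_have 3 → 1 := fun ⟨_, h⟩ => h.hasSeqWithoutCommonZero.isLeftProjective
  tfae_have 4 → 2 := fun _ => inferInstance
  tfae_have 2 → 4 := fun _ =>
    (hasSeqWithoutCommonZero_of_paracompactSpace ha₀).sigmaCompactSpace
  tfae_have 1 → 7 := fun h => h.h₂VanishesOnRightAnnihilator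
  tfae_have 7 → 1 := fun h => h.isLeftProjective
  tfae_finish

/-- A commutative C⋆-algebra of operators on a separable space has an element with trivial
annihilator. -/
theorem exists_forall_mul_eq_zero {A : Type*} [NonUnitalCommCStarAlgebra A] {H : Type*}
    [NormedAddCommGroup H] [InnerProductSpace ℂ H] [CompleteSpace H]
    [TopologicalSpace.SeparableSpace H] (π : A →⋆ₙₐ[ℂ] (H →L[ℂ] H))
    (hπ : Function.Injective π) : ∃ a₀ : A, ∀ b : A, b * a₀ = 0 → b = 0 := by
  -- A dense sequence of vectors $\pi(a)x$ involves only countably many $a$, which are condensed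
  -- into $a_0$ with the same common zeros.
  obtain ⟨u, hu⟩ := TopologicalSpace.exists_dense_seq
    (Set.range fun p : A × H => π p.1 p.2)
  choose p hp using fun n => (u n).2
  obtain ⟨a₀, -, ha₀⟩ := exists_character_eq_zero_iff fun n => (p n).1
  refine ⟨a₀, fun b hb => ?_⟩
  have hbn (n : ℕ) : b * (p n).1 = 0 := eq_of_forall_character fun χ => by
    have h := congrArg χ hb
    rw [map_mul, map_zero, mul_eq_zero] at h
    rw [map_mul, map_zero, mul_eq_zero]
    exact h.imp_right fun h => (ha₀ χ).2.2.1 h n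
  have hcl : IsClosed {x : Set.range fun p : A × H => π p.1 p.2 | π b x = 0} :=
    isClosed_eq ((π b).continuous.comp continuous_subtype_val) continuous_const
  have hall := hu.closure_eq ▸ closure_minimal (s := Set.range u) (by
    rintro _ ⟨n, rfl⟩
    change π b (u n : H) = 0
    rw [← hp n]
    change (π b * π (p n).1) (p n).2 = 0
    rw [← map_mul, hbn, map_zero, zero_apply]) hcl
  -- By density $\pi(b)$ kills every vector $\pi(a)x$, in particular those with $a=b^*$; no
  -- nondegeneracy of the representation is needed.
  have hbb : b * star b = 0 := hπ (by
    rw [map_mul, map_zero]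
    ext ξ
    exact hall (Set.mem_univ ⟨π (star b) ξ, (star b, ξ), rfl⟩))
  exact CStarRing.mul_star_self_eq_zero_iff b |>.1 hbb

end BanachHomology

theorem corollary6p4 {H : Type u} [NormedAddCommGroup H] [InnerProductSpace ℂ H] [CompleteSpace H]
    [TopologicalSpace.SeparableSpace H]
    (D : NonUnitalStarSubalgebra ℂ (H →L[ℂ] H)) (hclosed : IsClosed (D : Set (H →L[ℂ] H)))
    (hcomm : ∀ x ∈ D, ∀ y ∈ D, x * y = y * x) :
    List.TFAE [
      BanachHomology.IsLeftProjective D,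
      ParacompactSpace (WeakDual.characterSpace ℂ D),
      ∃ h : D, BanachHomology.IsStrictlyPositiveElement h,
      SigmaCompactSpace (WeakDual.characterSpace ℂ D),
      LindelofSpace (WeakDual.characterSpace ℂ D),
      BanachHomology.HasSequentialApproxIdentity D,
      BanachHomology.H₂VanishesOnRightAnnihilator D] := by
  let _ : NonUnitalCommCStarAlgebra D :=
    { NonUnitalStarSubalgebra.nonUnitalCStarAlgebra D (h_closed := hclosed) with
      mul_comm := fun x y => Subtype.ext (hcomm x x.2 y y.2) }
  obtain ⟨a₀, ha₀⟩ := BanachHomology.exists_forall_mul_eq_zero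
    (NonUnitalStarSubalgebraClass.subtype D) Subtype.val_injective
  exact BanachHomology.tfae_isLeftProjective ha₀
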